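/- Let $K\ge 2$, $E\ge 1$, $J_k:\mathbb R^{Q_k}\to\mathbb R$, $B_k\in\mathbb R^{E\times Q_k}$ ($k=1,\dots,K$) and $g:\mathbb R^E\to\mathbb R\cup\{+\infty\}$. For $w=\mathrm{col}\{w_1,\dots,w_K\}$ and $y=\mathrm{col}\{y_1,\dots,y_K\}$ with $w_k\in\mathbb R^{Q_k}$, $y_k\in\mathbb R^E$, put $\mathcal J(w)=\sum_k J_k(w_k)$, $B=[B_1\ \cdots\ B_K]$, $\mathcal B_d=\mathrm{blkdiag}\{B_1,\dots,B_K\}$ and $\mathcal G^*(y)=\frac1K\sum_k g^*(y_k)$, where $g^*(v)=\sup_x (v^{\mathsf T}x-g(x))$ is the conjugate of $g$. Let $\mathrm{prox}_{\mu f}(x)=\operatorname{argmin}_u\, f(u)+\frac1{2\mu}\|x-u\|^2$. Assume the following. 1. The problem $\min_w \mathcal J(w)+g(Bw)$ has a solution; $\mathcal J$ is differentiable and, for some $0<\nu\le\delta$ and all $w,w'$, $\|\nabla\mathcal J(w)-\nabla\mathcal J(w')\|\le\delta\|w-w'\|$ and $(w-w')^{\mathsf T}(\nabla\mathcal J(w)-\nabla\mathcal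 J(w'))\ge\nu\|w-w'\|^2$; $g$ is proper, lower semicontinuous and convex, and $Bw$ lies in the relative interior of the domain of $g$ for some $w$. 2. $\bar A\in\mathbb R^{K\times K}$ is primitive, symmetric and doubly stochastic, $\bar{\mathcal A}=\bar A\otimes I_E$, and $\mathcal L\in\mathbb R^{EK\times EK}$ is a symmetric matrix such that $\mathcal Ly=0\iff y_1=\cdots=y_K$, $0<I-\mathcal L^2$ and $\bar{\mathcal A}^2\le I-\mathcal L^2$ (in the positive semidefinite order). 3. Every $B_k$ has full row rank. 4. $0<\mu_w\le\frac{2}{\delta+\nu}$ and $0<\mu_y<\frac{2\delta\nu}{(\delta+\nu)\sigma_{\max}^2(\mathcal B_d)}$. Consider the proximal primal-dual algorithm, started from arbitrary $w_{-1},y_{-1}$ and $x_{-1}=0$: for $i\ge0$, $$\begin{aligned} w_i&=w_{i-1}-\mu_w\nabla\mathcal J(w_{i-1})-\mu_w\mathcal B_d^{\mathsf T}y_{i-1},\\ z_i&=y_{i-1}+\mu_y\mathcal B_dw_i+\mathcal Lx_{i-1},\\ x_i&=x_{i-1}-\mathcal Lz_i,\\ y_i&=\mathrm{prox}_{\mu_y\mathcal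 G^*}(\bar{\mathcal A}z_i).\end{aligned}$$ Then the algorithm has a fixed point, that is, a tuple $(w^o,x^o,y^o,z^o)$ with $$0=\nabla\mathcal J(w^o)+\mathcal B_d^{\mathsf T}y^o,\quad z^o=y^o+\mu_y\mathcal B_dw^o+\mathcal Lx^o,\quad 0=\mathcal Lz^o,\quad y^o=\mathrm{prox}_{\mu_y\mathcal G^*}(\bar{\mathcal A}z^o),$$ and the number $$\gamma=\max\left\{\frac{1-\frac{2\mu_w\delta\nu}{\delta+\nu}}{1-\mu_y\mu_w\sigma_{\max}^2(\mathcal B_d)},\ 1-\mu_w\mu_y\lambda_{\min}(\mathcal B_d\mathcal B_d^{\mathsf T}),\ 1-\underline\sigma^2(\mathcal L)\right\}$$ satisfies $\gamma<1$, where $\sigma_{\max}$ is the largest singular value, $\lambda_{\min}$ the smallest eigenvalue and $\underline\sigma(\mathcal L)$ the smallest nonzero singular value. Moreover, for every fixed point and every run of the algorithm there is a constant $C_o\ge0$ such that $$\|w_i-w^o\|^2\le\gamma^i\,C_o\qquad\text{for all } i\ge0.$$ -/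

import Mathlib

noncomputable section

namespace Sharing

/-! ### Smooth and strongly convex functions -/

/-- `f` is differentiable with `δ`-Lipschitz gradient. -/
def IsSmooth {V : Type*} [NormedAddCommGroup V] [InnerProductSpace ℝ V] [CompleteSpace V]
    (δ : ℝ) (f : V → ℝ) : Prop :=
  Differentiable ℝ f ∧ ∀ x y, ‖gradient f x - gradient f y‖ ≤ δ * ‖x - y‖

/-- `f` is differentiable with `(x - y)ᵀ(∇f x - ∇f y) ≥ ν ‖x - y‖²` for all `x`, `y`. -/
def IsStronglyConvex {V : Type*} [NormedAddCommGroup V] [InnerProductSpace ℝ V] [CompleteSpace V]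
    (ν : ℝ) (f : V → ℝ) : Prop :=
  Differentiable ℝ f ∧
    ∀ x y, ν * ‖x - y‖ ^ 2 ≤ inner ℝ (x - y) (gradient f x - gradient f y)

/-! ### Extended-real-valued functions -/

/-- `g` never takes the value `-∞` and is finite somewhere. -/
def IsProper {V : Type*} (g : V → EReal) : Prop :=
  (∀ x, g x ≠ ⊥) ∧ ∃ x, g x ≠ ⊤

/-- `g` is convex: its epigraph is a convex set. -/
def IsConvex {V : Type*} [AddCommMonoid V] [Module ℝ V] (g : V → EReal) : Prop :=
  Convex ℝ {p : V × ℝ | g p.1 ≤ (p.2 : EReal)}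

/-- The effective domain of `g`. -/
def effDom {V : Type*} (g : V → EReal) : Set V := {x | g x < ⊤}

/-- The conjugate `g*(v) = sup_x (vᵀ x - g x)`. -/
def conjugate {V : Type*} [NormedAddCommGroup V] [InnerProductSpace ℝ V]
    (g : V → EReal) (v : V) : EReal :=
  ⨆ x, (((inner ℝ v x : ℝ) : EReal) - g x)

/-- `u` is a value of the proximal operator `prox_{μ f}` at `x`, i.e.
`u ∈ argmin_v (f v + ‖x - v‖² / (2μ))`. -/
def IsProx {V : Type*} [NormedAddCommGroup V] (μ : ℝ) (f : V → EReal) (x u : V) : Prop :=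
  ∀ v, f u + ((1 / (2 * μ) * ‖x - u‖ ^ 2 : ℝ) : EReal) ≤
    f v + ((1 / (2 * μ) * ‖x - v‖ ^ 2 : ℝ) : EReal)

/-! ### Spectral quantities of real matrices -/

/-- The largest singular value (Mathlib's singular values are listed in decreasing order). -/
def sigmaMax {m n : Type*} [Fintype m] [Fintype n] [DecidableEq m] [DecidableEq n]
    (M : Matrix m n ℝ) : ℝ :=
  (Matrix.toEuclideanLin M).singularValues 0

/-- The smallest nonzero singular value. -/
def sigmaMinNonzero {m n : Type*} [Fintype m] [Fintype n] [DecidableEq m] [DecidableEq n]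
    (M : Matrix m n ℝ) : ℝ :=
  sInf {s : ℝ | s ≠ 0 ∧ ∃ i : ℕ, (Matrix.toEuclideanLin M).singularValues i = s}

/-- The smallest (real) eigenvalue; used for symmetric matrices only. -/
def lambdaMin {n : Type*} [Fintype n] [DecidableEq n] (M : Matrix n n ℝ) : ℝ :=
  sInf {t : ℝ | Module.End.HasEigenvalue (Matrix.toLin' M) t}

/-! ### The multi-agent problem -/

/-- Stacked primal vectors `w = col{w_1, …, w_K}` with `w_k ∈ ℝ^{Q_k}`. -/
abbrev Primal (K : ℕ) (Q : Fin K → ℕ) : Type := EuclideanSpace ℝ (Σ k : Fin K, Fin (Q k))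

/-- Stacked vectors `y = col{y_1, …, y_K}` with `y_k ∈ ℝ^E`. -/
abbrev Dual (K E : ℕ) : Type := EuclideanSpace ℝ (Fin K × Fin E)

variable {K E : ℕ} {Q : Fin K → ℕ}

/-- The block `w_k` of `w`. -/
def Primal.block (w : Primal K Q) (k : Fin K) : EuclideanSpace ℝ (Fin (Q k)) :=
  WithLp.toLp 2 fun j => w ⟨k, j⟩

/-- The block `y_k` of `y`. -/
def Dual.block (y : Dual K E) (k : Fin K) : EuclideanSpace ℝ (Fin E) :=
  WithLp.toLp 2 fun e => y (k, e)

/-- The aggregate cost `𝒥(w) = ∑ₖ J_k(w_k)`. -/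
def totalCost (J : (k : Fin K) → EuclideanSpace ℝ (Fin (Q k)) → ℝ) (w : Primal K Q) : ℝ :=
  ∑ k, J k (Primal.block w k)

/-- `B = [B_1 ⋯ B_K]`. -/
def rowConcat (B : (k : Fin K) → Matrix (Fin E) (Fin (Q k)) ℝ) :
    Matrix (Fin E) (Σ k : Fin K, Fin (Q k)) ℝ :=
  Matrix.of fun e q => B q.1 e q.2

/-- `𝓑_d = blkdiag{B_1, …, B_K}`. -/
def blockDiag (B : (k : Fin K) → Matrix (Fin E) (Fin (Q k)) ℝ) :
    Matrix (Fin K × Fin E) (Σ k : Fin K, Fin (Q k)) ℝ :=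
  Matrix.of fun p q => if p.1 = q.1 then B q.1 p.2 q.2 else 0

/-- `𝓐 = A ⊗ I_E`. -/
def kronId (E : ℕ) (A : Matrix (Fin K) (Fin K) ℝ) : Matrix (Fin K × Fin E) (Fin K × Fin E) ℝ :=
  Matrix.kronecker A (1 : Matrix (Fin E) (Fin E) ℝ)

/-- `𝒢*(y) = (1/K) ∑ₖ g*(y_k)`. -/
def avgConjugate (g : EuclideanSpace ℝ (Fin E) → EReal) (y : Dual K E) : EReal :=
  ((1 / (K : ℝ) : ℝ) : EReal) * ∑ k, conjugate g (Dual.block y k)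

/-- The assumption on the objective: the problem `min_w 𝒥(w) + g(B w)` has a solution, `𝒥` is
`δ`-smooth and `ν`-strongly convex with `0 < ν ≤ δ`, `g` is proper, lower semicontinuous and
convex, and some `B w` lies in the relative interior of the domain of `g`. -/
structure ObjectiveAssumption (J : (k : Fin K) → EuclideanSpace ℝ (Fin (Q k)) → ℝ)
    (g : EuclideanSpace ℝ (Fin E) → EReal) (B : (k : Fin K) → Matrix (Fin E) (Fin (Q k)) ℝ)
    (δ ν : ℝ) : Prop where
  exists_solution : ∃ wStar : Primal K Q, ∀ w : Primal K Q,
    (totalCost J wStar : EReal) + g (Matrix.toEuclideanLin (rowConcat B) wStar) ≤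
      (totalCost J w : EReal) + g (Matrix.toEuclideanLin (rowConcat B) w)
  nu_pos : 0 < ν
  nu_le_delta : ν ≤ δ
  smooth : IsSmooth δ (totalCost J)
  stronglyConvex : IsStronglyConvex ν (totalCost J)
  proper : IsProper g
  lsc : LowerSemicontinuous g
  convex : IsConvex g
  qualification : ∃ w : Primal K Q,
    Matrix.toEuclideanLin (rowConcat B) w ∈ intrinsicInterior ℝ (effDom g)

/-- The assumption on the combination matrices: `A` is primitive, symmetric and doubly stochastic,
`L` is symmetric with `L y = 0 ↔ y_1 = ⋯ = y_K`, and `0 < I - L²`, `𝓐² ≤ I - L²` in the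
positive semidefinite order. -/
structure CombinationAssumption (A : Matrix (Fin K) (Fin K) ℝ)
    (L : Matrix (Fin K × Fin E) (Fin K × Fin E) ℝ) : Prop where
  primitive : A.IsPrimitive
  symm : A.IsSymm
  doublyStochastic : A ∈ doublyStochastic ℝ (Fin K)
  symm_L : L.IsSymm
  consensus : ∀ y : Dual K E,
    Matrix.toEuclideanLin L y = 0 ↔ ∀ k l, Dual.block y k = Dual.block y l
  posDef : (1 - L ^ 2).PosDef
  le : ((1 - L ^ 2) - kronId E A ^ 2).PosSemidef

/-- `(w, z, x, y)` is a run of the proximal primal-dual algorithm. The term with index `i + 1`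
of each sequence is the iterate number `i`, so that index `0` holds the initial values (number
`-1`): `w 0`, `y 0` are arbitrary, `x 0 = 0`, and `z 0` is not used. -/
structure IsRun (J : (k : Fin K) → EuclideanSpace ℝ (Fin (Q k)) → ℝ)
    (g : EuclideanSpace ℝ (Fin E) → EReal) (B : (k : Fin K) → Matrix (Fin E) (Fin (Q k)) ℝ)
    (A : Matrix (Fin K) (Fin K) ℝ) (L : Matrix (Fin K × Fin E) (Fin K × Fin E) ℝ)
    (μw μy : ℝ) (w : ℕ → Primal K Q) (z x y : ℕ → Dual K E) : Prop where
  init : x 0 = 0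
  w_step : ∀ i, w (i + 1) = w i - μw • gradient (totalCost J) (w i)
    - μw • Matrix.toEuclideanLin (blockDiag B).transpose (y i)
  z_step : ∀ i, z (i + 1) = y i + μy • Matrix.toEuclideanLin (blockDiag B) (w (i + 1))
    + Matrix.toEuclideanLin L (x i)
  x_step : ∀ i, x (i + 1) = x i - Matrix.toEuclideanLin L (z (i + 1))
  y_step : ∀ i, IsProx μy (avgConjugate g)
    (Matrix.toEuclideanLin (kronId E A) (z (i + 1))) (y (i + 1))

/-- `(w, x, y, z)` is a fixed point of the algorithm. -/
structure IsFixedPoint (J : (k : Fin K) → EuclideanSpace ℝ (Fin (Q k)) → ℝ)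
    (g : EuclideanSpace ℝ (Fin E) → EReal) (B : (k : Fin K) → Matrix (Fin E) (Fin (Q k)) ℝ)
    (A : Matrix (Fin K) (Fin K) ℝ) (L : Matrix (Fin K × Fin E) (Fin K × Fin E) ℝ)
    (μy : ℝ) (w : Primal K Q) (x y z : Dual K E) : Prop where
  w_eq : 0 = gradient (totalCost J) w + Matrix.toEuclideanLin (blockDiag B).transpose y
  z_eq : z = y + μy • Matrix.toEuclideanLin (blockDiag B) w + Matrix.toEuclideanLin L x
  x_eq : 0 = Matrix.toEuclideanLin L z
  y_eq : IsProx μy (avgConjugate g) (Matrix.toEuclideanLin (kronId E A) z) y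

/-- The rate `γ`, the largest of the three contraction factors. -/
def rate (B : (k : Fin K) → Matrix (Fin E) (Fin (Q k)) ℝ)
    (L : Matrix (Fin K × Fin E) (Fin K × Fin E) ℝ) (δ ν μw μy : ℝ) : ℝ :=
  max (max
    ((1 - 2 * μw * δ * ν / (δ + ν)) / (1 - μy * μw * sigmaMax (blockDiag B) ^ 2))
    (1 - μw * μy * lambdaMin (blockDiag B * (blockDiag B).transpose)))
    (1 - sigmaMinNonzero L ^ 2)

end Sharing

end

open Sharing

/-! The proof exhibits a weighted squared distance to a fixed point that shrinks by the factor `γ`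
at every step: `V = c ‖w - wo‖² + ‖y - yo‖² + ‖x - xo‖²`, with `c = (μy/μw)(1 - μy μw σ_max²)`. Four
facts about the errors combine. The gradient step alone contracts (`norm_sq_gradient_step_le`), by
coercivity of the gradient of a smooth strongly convex function. Two exact identities
(`primal_energy_identity`, `dual_energy_identity`) absorb the couplings through `𝓑_d` and `L`: their
cross terms cancel and leave the gains `-μw μy ‖𝓑_dᵀ y‖²` and `-‖L x‖²`. Finally the prox is
nonexpansive and `𝓐² ≤ I - L²`, so the new `y` error is at most `‖z‖² - ‖L z‖²`, exactly the term
produced by the dual identity. Bounding each gain spectrally gives one entry of `γ` per variable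
(`IsRun.energy_succ_le`). The gain in `x` is controlled only on the range of `L`. The iterates stay
there because `x` starts at `0`, and `xo` may be projected there because it enters the fixed-point
equations only through `L xo`. For existence, a minimizer `w` and a subgradient `y` of `g` at `B w`
with `Bᵀ y = -∇𝒥(w)` are lifted to consensual `yo` and `zo`; what `xo` must correct has blocks
summing to zero, hence lies in the range of `L`. -/

open Sharing

/-! ### Coercivity of the gradient and contraction of the gradient step. -/

section Coercivity

variable {V : Type*} [NormedAddCommGroup V] [InnerProductSpace ℝ V] [CompleteSpace V]

theorem HasGradientAt.hasDerivAt_comp_line {f : V → ℝ} {G x d : V} {t : ℝ}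
    (h : HasGradientAt f G (x + t • d)) :
    HasDerivAt (fun s : ℝ => f (x + s • d)) (inner ℝ G d) t := by
  have h1 : HasDerivAt (fun s : ℝ => x + s • d) d t := by
    simpa using ((hasDerivAt_id t).smul_const d).const_add x
  have h2 := h.hasFDerivAt.comp_hasDerivAt t h1
  rwa [InnerProductSpace.toDual_apply_apply] at h2

/-- A lower curvature bound on the gradient gives a quadratic lower bound on the function. -/
theorem add_inner_add_sq_le_of_hasGradientAt {f : V → ℝ} {G : V → V} {c : ℝ}
    (hf : ∀ x, HasGradientAt f (G x) x)
    (hG : ∀ x y, c * ‖x - y‖ ^ 2 ≤ inner ℝ (x - y) (G x - G y)) (x y : V) :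
    f x + inner ℝ (G x) (y - x) + c / 2 * ‖y - x‖ ^ 2 ≤ f y := by
  set d := y - x with hd
  -- Along the segment, `f` minus its claimed quadratic minorant has nonnegative derivative. No sign
  -- of `c` is needed; the smooth case applies this to `-f` with `c = -δ`.
  have hder : ∀ t : ℝ, HasDerivAt
      (fun s : ℝ => f (x + s • d) - s * inner ℝ (G x) d - c / 2 * ‖d‖ ^ 2 * s ^ 2)
      (inner ℝ (G (x + t • d)) d - inner ℝ (G x) d - c * ‖d‖ ^ 2 * t) t := by
    intro t
    have h1 := (hf (x + t • d)).hasDerivAt_comp_line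
    have h2 := ((hasDerivAt_id t).mul_const (inner ℝ (G x) d))
    have h3 := ((hasDerivAt_id t).pow 2).const_mul (c / 2 * ‖d‖ ^ 2)
    convert! (h1.sub h2).sub h3 using 1
    simp; ring
  have hmono : MonotoneOn
      (fun s : ℝ => f (x + s • d) - s * inner ℝ (G x) d - c / 2 * ‖d‖ ^ 2 * s ^ 2)
      (Set.Icc 0 1) := by
    refine monotoneOn_of_hasDerivWithinAt_nonneg (convex_Icc 0 1)
      (fun t _ => (hder t).continuousAt.continuousWithinAt)
      (fun t _ => (hder t).hasDerivWithinAt) ?_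
    intro t ht
    rw [interior_Icc] at ht
    have h := hG (x + t • d) x
    rw [add_sub_cancel_left, norm_smul, real_inner_smul_left, inner_sub_right,
      Real.norm_of_nonneg ht.1.le, real_inner_comm (G (x + t • d)) d, real_inner_comm (G x) d] at h
    have : 0 ≤ t * (inner ℝ (G (x + t • d)) d - inner ℝ (G x) d - c * ‖d‖ ^ 2 * t) := by
      nlinarith
    exact (mul_nonneg_iff_of_pos_left ht.1).1 this
  have h01 := hmono (Set.left_mem_Icc.2 zero_le_one) (Set.right_mem_Icc.2 zero_le_one) zero_le_one
  simp only [zero_smul, add_zero, one_smul, hd, add_sub_cancel] at h01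
  rw [hd]
  linarith

theorem Sharing.IsSmooth.le_add_inner_add_sq {f : V → ℝ} {δ : ℝ} (hf : IsSmooth δ f) (x y : V) :
    f y ≤ f x + inner ℝ (gradient f x) (y - x) + δ / 2 * ‖y - x‖ ^ 2 := by
  have h := add_inner_add_sq_le_of_hasGradientAt (f := fun x => - f x)
    (G := fun x => - gradient f x) (c := -δ)
    (fun x => by
      have := ((hf.1 x).hasGradientAt).hasFDerivAt.neg
      rw [hasGradientAt_iff_hasFDerivAt, map_neg]
      exact this)
    (fun x y => by
      have h1 := real_inner_le_norm (x - y) (gradient f x - gradient f y)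
      have h2 := mul_le_mul_of_nonneg_left (hf.2 x y) (norm_nonneg (x - y))
      rw [show - gradient f x - - gradient f y = -(gradient f x - gradient f y) by abel,
        inner_neg_right]
      nlinarith) x y
  rw [inner_neg_left] at h
  linarith

theorem Sharing.IsStronglyConvex.add_inner_add_sq_le {f : V → ℝ} {ν : ℝ} (hf : IsStronglyConvex ν f)
    (x y : V) :
    f x + inner ℝ (gradient f x) (y - x) + ν / 2 * ‖y - x‖ ^ 2 ≤ f y :=
  add_inner_add_sq_le_of_hasGradientAt (fun x => (hf.1 x).hasGradientAt) hf.2 x y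

/-- One-sided estimate behind the cocoercivity of the gradient of `f - ν/2 ‖·‖²`. -/
theorem bregman_sub_sq_ge {f : V → ℝ} {δ ν : ℝ} (hs : IsSmooth δ f)
    (hc : IsStronglyConvex ν f) (x y : V) (t : ℝ) :
    f x + inner ℝ (gradient f x) (y - x) + ν / 2 * ‖y - x‖ ^ 2
      + (t - (δ - ν) / 2 * t ^ 2)
        * ‖gradient f y - gradient f x - ν • (y - x)‖ ^ 2 ≤ f y := by
  set p := gradient f y - gradient f x - ν • (y - x) with hp
  -- The value at the trial point `y - t • p` is bounded above by smoothness at `y` and below by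
  -- strong convexity at `x`.
  have h1 := hs.le_add_inner_add_sq y (y - t • p)
  have h2 := hc.add_inner_add_sq_le x (y - t • p)
  have e1 : y - t • p - y = - (t • p) := by abel
  have e2 : y - t • p - x = (y - x) - t • p := by abel
  rw [e1, inner_neg_right, norm_neg, real_inner_smul_right, norm_smul, mul_pow,
    Real.norm_eq_abs, sq_abs] at h1
  rw [e2, inner_sub_right, real_inner_smul_right, norm_sub_sq_real, real_inner_smul_right,
    norm_smul, mul_pow, Real.norm_eq_abs, sq_abs] at h2
  have h3 : inner ℝ (gradient f y) p - inner ℝ (gradient f x) p - ν * inner ℝ (y - x) p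
      = ‖p‖ ^ 2 := by
    rw [← real_inner_self_eq_norm_sq, ← real_inner_smul_left, ← inner_sub_left, ← inner_sub_left]
  linear_combination h1 + h2 - t * h3

/-- Coercivity of the gradient of a smooth and strongly convex function. -/
theorem gradient_coercive {f : V → ℝ} {δ ν : ℝ} (hνδ : ν ≤ δ) (hs : IsSmooth δ f)
    (hc : IsStronglyConvex ν f) (x y : V) :
    ‖gradient f x - gradient f y‖ ^ 2 + δ * ν * ‖x - y‖ ^ 2 ≤
      (δ + ν) * inner ℝ (x - y) (gradient f x - gradient f y) := by
  set p := gradient f x - gradient f y with hp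
  set d := x - y with hd
  -- Adding the one-sided estimates for `(x, y)` and `(y, x)` eliminates the function values.
  have key : ∀ t : ℝ, (2 * t - (δ - ν) * t ^ 2) * ‖p - ν • d‖ ^ 2 ≤
      inner ℝ d p - ν * ‖d‖ ^ 2 := by
    intro t
    have h1 := bregman_sub_sq_ge hs hc y x t
    have h2 := bregman_sub_sq_ge hs hc x y t
    rw [← hp, ← hd] at h1
    rw [show y - x = -d by simp [hd], show gradient f y - gradient f x = -p by simp [hp],
      show -p - ν • -d = -(p - ν • d) by rw [smul_neg]; abel, norm_neg, norm_neg,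
      inner_neg_right] at h2
    have h3 : inner ℝ (gradient f x) d - inner ℝ (gradient f y) d = inner ℝ d p := by
      rw [← inner_sub_left, real_inner_comm]
    linarith
  have hexp : ‖p - ν • d‖ ^ 2 = ‖p‖ ^ 2 - 2 * ν * inner ℝ d p + ν ^ 2 * ‖d‖ ^ 2 := by
    rw [norm_sub_sq_real, real_inner_smul_right, norm_smul, mul_pow, Real.norm_eq_abs, sq_abs,
      real_inner_comm]
    ring
  suffices h : ‖p - ν • d‖ ^ 2 ≤ (δ - ν) * (inner ℝ d p - ν * ‖d‖ ^ 2) by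
    rw [hexp] at h
    linarith
  rcases hνδ.eq_or_lt with rfl | hlt
  -- For `δ = ν` the left side of `key` is linear in `t`, so a large `t` forces `p = ν • d`;
  -- otherwise `t = 1 / (δ - ν)` is optimal.
  · have hn : ‖p - ν • d‖ ^ 2 ≤ 0 := by
      by_contra! hpos
      have h := key ((inner ℝ d p - ν * ‖d‖ ^ 2 + 1) / (2 * ‖p - ν • d‖ ^ 2))
      rw [sub_self, zero_mul, sub_zero] at h
      have : 2 * ((inner ℝ d p - ν * ‖d‖ ^ 2 + 1) / (2 * ‖p - ν • d‖ ^ 2)) * ‖p - ν • d‖ ^ 2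
        = inner ℝ d p - ν * ‖d‖ ^ 2 + 1 := by
        have hne := hpos.ne'
        generalize ‖p - ν • d‖ ^ 2 = q at hne ⊢
        field_simp
      linarith
    simpa using hn
  · have hpos : 0 < δ - ν := sub_pos.2 hlt
    have h := key (1 / (δ - ν))
    have e : 2 * (1 / (δ - ν)) - (δ - ν) * (1 / (δ - ν)) ^ 2 = 1 / (δ - ν) := by
      field_simp; ring
    rw [e] at h
    calc ‖p - ν • d‖ ^ 2 = (δ - ν) * (1 / (δ - ν) * ‖p - ν • d‖ ^ 2) := by field_simp
      _ ≤ _ := mul_le_mul_of_nonneg_left h hpos.le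

/-- A gradient step is a contraction. -/
theorem norm_sq_gradient_step_le {f : V → ℝ} {δ ν μ : ℝ} (hν : 0 < ν) (hνδ : ν ≤ δ)
    (hs : IsSmooth δ f) (hc : IsStronglyConvex ν f) (hμ : 0 < μ) (hμ_le : μ ≤ 2 / (δ + ν))
    (x y : V) :
    ‖(x - y) - μ • (gradient f x - gradient f y)‖ ^ 2 ≤
      (1 - 2 * μ * δ * ν / (δ + ν)) * ‖x - y‖ ^ 2 := by
  have h := gradient_coercive hνδ hs hc x y
  rw [norm_sub_sq_real, real_inner_smul_right, norm_smul, mul_pow, Real.norm_eq_abs, sq_abs]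
  have hpos : 0 < δ + ν := by linarith
  rw [le_div_iff₀ hpos] at hμ_le
  set a := inner ℝ (x - y) (gradient f x - gradient f y)
  set b := ‖gradient f x - gradient f y‖ ^ 2 with hb
  have hb0 : 0 ≤ b := by positivity
  have h1 : (b + δ * ν * ‖x - y‖ ^ 2) / (δ + ν) ≤ a := by
    rw [div_le_iff₀ hpos]; linarith
  have h2 : μ * b ≤ 2 / (δ + ν) * b :=
    mul_le_mul_of_nonneg_right ((le_div_iff₀ hpos).2 hμ_le) hb0
  have h3 := mul_le_mul_of_nonneg_left h1 hμ.le
  have h4 := mul_le_mul_of_nonneg_left h2 hμ.le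
  have h5 : 2 * μ * δ * ν / (δ + ν) * ‖x - y‖ ^ 2 + μ * (2 / (δ + ν) * b)
    = 2 * (μ * ((b + δ * ν * ‖x - y‖ ^ 2) / (δ + ν))) := by field_simp; ring
  linarith

end Coercivity

/-! ### Proximal points and conjugates of extended-valued functions. -/

section Prox

variable {V : Type*} [NormedAddCommGroup V] [InnerProductSpace ℝ V]

/-- The minimality of a proximal point, as a variational inequality. -/
theorem Sharing.IsProx.inner_le {μ : ℝ} (hμ : 0 < μ) {f : V → EReal} {x u v : V} {a b : ℝ}
    (hu : IsProx μ f x u) (ha : f u = a)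
    (hconv : ∀ t : ℝ, 0 ≤ t → t ≤ 1 → f (u + t • (v - u)) ≤ ((1 - t) * a + t * b : ℝ)) :
    inner ℝ (x - u) (v - u) ≤ μ * (b - a) := by
  -- Compare `u` with `u + t • (v - u)` and divide by `t / μ`; the quadratic remainder vanishes as
  -- `t → 0`.
  have key : ∀ t : ℝ, 0 < t → t ≤ 1 →
      inner ℝ (x - u) (v - u) ≤ μ * (b - a) + t * (‖v - u‖ ^ 2 / 2) := by
    intro t h0 h1
    have h := (hu (u + t • (v - u))).trans (add_le_add_left (hconv t h0.le h1) _)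
    rw [ha] at h
    norm_cast at h
    rw [show x - (u + t • (v - u)) = (x - u) - t • (v - u) by abel, norm_sub_sq_real (x - u) (t • (v - u)),
      real_inner_smul_right, norm_smul, mul_pow, Real.norm_eq_abs, sq_abs] at h
    have e : 1 / (2 * μ) * (2 * (t * inner ℝ (x - u) (v - u)))
      ≤ t * (b - a) + 1 / (2 * μ) * (t ^ 2 * ‖v - u‖ ^ 2) := by linarith
    have e2 := mul_le_mul_of_nonneg_left e (show 0 ≤ μ / t by positivity)
    have e3 : μ / t * (1 / (2 * μ) * (2 * (t * inner ℝ (x - u) (v - u))))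
      = inner ℝ (x - u) (v - u) := by field_simp
    have e4 : μ / t * (t * (b - a) + 1 / (2 * μ) * (t ^ 2 * ‖v - u‖ ^ 2))
      = μ * (b - a) + t * (‖v - u‖ ^ 2 / 2) := by field_simp
    linarith
  refine le_of_forall_pos_le_add fun ε hε => ?_
  set s := ‖v - u‖ ^ 2 / 2
  have hs : 0 ≤ s := by positivity
  have h := key (min 1 (ε / (s + 1))) (by positivity) (min_le_left _ _)
  have h2 : min 1 (ε / (s + 1)) * s ≤ ε := by
    calc _ ≤ ε / (s + 1) * s := mul_le_mul_of_nonneg_right (min_le_right _ _) hs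
      _ ≤ ε / (s + 1) * (s + 1) := mul_le_mul_of_nonneg_left (by linarith) (by positivity)
      _ = ε := by field_simp
  linarith

/-- Convexity of an extended-valued function along segments between points of its domain. -/
def SegmentConvex (f : V → EReal) : Prop :=
  ∀ (u v : V) (a b t : ℝ), f u = a → f v = b → 0 ≤ t → t ≤ 1 →
    f (u + t • (v - u)) ≤ ((1 - t) * a + t * b : ℝ)

/-- The proximal operator of a convex function is nonexpansive. -/
theorem Sharing.IsProx.norm_sub_le {μ : ℝ} (hμ : 0 < μ) {f : V → EReal} (hbot : ∀ v, f v ≠ ⊥)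
    (htop : ∃ v, f v ≠ ⊤) (hf : SegmentConvex f) {x x' u u' : V}
    (hu : IsProx μ f x u) (hu' : IsProx μ f x' u') : ‖u - u'‖ ≤ ‖x - x'‖ := by
  have fin : ∀ {x u : V}, IsProx μ f x u → ∃ a : ℝ, f u = a := by
    intro x u h
    obtain ⟨v, hv⟩ := htop
    lift f v to ℝ using ⟨hv, hbot v⟩ with c hc
    have h1 := h v
    rw [← hc] at h1
    have : f u ≠ ⊤ := by
      intro htop
      rw [htop, EReal.top_add_coe] at h1
      norm_cast at h1
    lift f u to ℝ using ⟨this, hbot u⟩ with a ha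
    exact ⟨a, rfl⟩
  obtain ⟨a, ha⟩ := fin hu
  obtain ⟨b, hb⟩ := fin hu'
  have h1 := hu.inner_le hμ ha (fun t h0 h1 => hf u u' a b t ha hb h0 h1)
  have h2 := hu'.inner_le hμ hb (fun t h0 h1 => hf u' u b a t hb ha h0 h1)
  -- The two variational inequalities add up to `‖u - u'‖² ≤ ⟨x - x', u - u'⟩`; Cauchy–Schwarz
  -- finishes.
  have h3 : inner ℝ (x - u) (u' - u) + inner ℝ (x' - u') (u - u')
    = ‖u - u'‖ ^ 2 - inner ℝ (x - x') (u - u') := by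
    rw [← real_inner_self_eq_norm_sq, show u' - u = -(u - u') by abel, inner_neg_right,
      ← inner_neg_left, ← inner_add_left, ← inner_sub_left]
    congr 1; abel
  have h4 := real_inner_le_norm (x - x') (u - u')
  by_contra! hlt
  nlinarith [norm_nonneg (x - x'), norm_nonneg (u - u')]

theorem inner_sub_le_conjugate {g : V → EReal} {x : V} {r : ℝ} (hr : g x = r) (v : V) :
    ((inner ℝ v x - r : ℝ) : EReal) ≤ conjugate g v := by
  refine le_trans (le_of_eq ?_) (le_iSup (fun x => (((inner ℝ v x : ℝ) : EReal) - g x)) x)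
  rw [hr]; norm_cast

theorem conjugate_le_coe {g : V → EReal} (hbot : ∀ x, g x ≠ ⊥) {v : V} {c : ℝ}
    (h : ∀ (x : V) (r : ℝ), g x = r → inner ℝ v x - r ≤ c) : conjugate g v ≤ c := by
  refine iSup_le fun x => ?_
  by_cases hx : g x = ⊤
  · rw [hx]; simp
  · lift g x to ℝ using ⟨hx, hbot x⟩ with r hr
    exact_mod_cast h x r hr.symm

theorem conjugate_ne_bot {g : V → EReal} (hg : IsProper g) (v : V) : conjugate g v ≠ ⊥ := by
  obtain ⟨x, hx⟩ := hg.2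
  obtain ⟨r, hr⟩ : ∃ r : ℝ, g x = r := by
    lift g x to ℝ using ⟨hx, hg.1 x⟩ with r hr
    exact ⟨r, rfl⟩
  exact ne_bot_of_le_ne_bot (EReal.coe_ne_bot _) (inner_sub_le_conjugate hr v)

/-- A conjugate is a supremum of affine functions, one for each point where `g` is finite. -/
theorem segmentConvex_conjugate {g : V → EReal} (hg : IsProper g) :
    SegmentConvex (conjugate g) := by
  intro u v a b t hu hv h0 h1
  refine conjugate_le_coe hg.1 fun x r hr => ?_
  have h2 := inner_sub_le_conjugate hr u
  have h3 := inner_sub_le_conjugate hr v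
  rw [hu, EReal.coe_le_coe_iff] at h2
  rw [hv, EReal.coe_le_coe_iff] at h3
  rw [inner_add_left, real_inner_smul_left, inner_sub_left]
  nlinarith [mul_le_mul_of_nonneg_left h2 (sub_nonneg.2 h1), mul_le_mul_of_nonneg_left h3 h0]

end Prox

theorem norm_sq_eq_sum_inner {V : Type*} [NormedAddCommGroup V] [InnerProductSpace ℝ V] {n : ℕ}
    (b : OrthonormalBasis (Fin n) ℝ V) (v : V) :
    ‖v‖ ^ 2 = ∑ i, inner ℝ (b i) v ^ 2 := by
  rw [← real_inner_self_eq_norm_sq, ← b.sum_inner_mul_inner]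
  refine Finset.sum_congr rfl fun i _ => ?_
  rw [real_inner_comm (b i) v]; ring

/-! ### Spectral bounds by expansion in eigenbases. -/

section Spectral

variable {V W : Type*} [NormedAddCommGroup V] [InnerProductSpace ℝ V] [FiniteDimensional ℝ V]
  [NormedAddCommGroup W] [InnerProductSpace ℝ W] [FiniteDimensional ℝ W]

theorem LinearMap.IsSymmetric.inner_apply_self_eq_sum {T : V →ₗ[ℝ] V} (hT : T.IsSymmetric)
    {n : ℕ} (hn : Module.finrank ℝ V = n) (v : V) :
    inner ℝ v (T v) = ∑ i, hT.eigenvalues hn i * inner ℝ (hT.eigenvectorBasis hn i) v ^ 2 := by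
  rw [← (hT.eigenvectorBasis hn).sum_inner_mul_inner]
  refine Finset.sum_congr rfl fun i _ => ?_
  rw [← hT, hT.apply_eigenvectorBasis, real_inner_smul_left,
    real_inner_comm (hT.eigenvectorBasis hn i) v]
  simp; ring

theorem norm_sq_apply_eq_sum_singularValues (T : V →ₗ[ℝ] W) (v : V) :
    ‖T v‖ ^ 2 = ∑ i : Fin (Module.finrank ℝ V), T.singularValues i ^ 2 *
      inner ℝ (T.isSymmetric_adjoint_comp_self.eigenvectorBasis rfl i) v ^ 2 := by
  have h := T.isSymmetric_adjoint_comp_self.inner_apply_self_eq_sum rfl v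
  rw [LinearMap.comp_apply, LinearMap.adjoint_inner_right, real_inner_self_eq_norm_sq] at h
  rw [h]
  refine Finset.sum_congr rfl fun i _ => ?_
  rw [T.sq_singularValues_fin rfl]

theorem norm_sq_apply_le_singularValues_zero (T : V →ₗ[ℝ] W) (v : V) :
    ‖T v‖ ^ 2 ≤ T.singularValues 0 ^ 2 * ‖v‖ ^ 2 := by
  rw [norm_sq_apply_eq_sum_singularValues,
    norm_sq_eq_sum_inner (T.isSymmetric_adjoint_comp_self.eigenvectorBasis rfl), Finset.mul_sum]
  refine Finset.sum_le_sum fun i _ => mul_le_mul_of_nonneg_right ?_ (sq_nonneg _)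
  have h := T.singularValues_antitone (Nat.zero_le i)
  exact pow_le_pow_left₀ (T.singularValues_nonneg _) h 2

theorem setOf_singularValues_ne_zero_finite (T : V →ₗ[ℝ] W) :
    {s : ℝ | s ≠ 0 ∧ ∃ i : ℕ, T.singularValues i = s}.Finite := by
  refine (T.singularValues.support.finite_toSet.image T.singularValues).subset ?_
  rintro s ⟨hs, i, rfl⟩
  exact ⟨i, Finsupp.mem_support_iff.2 hs, rfl⟩

/-- On the range of a symmetric map the norm grows by at least the smallest nonzero singular
value. -/
theorem sInf_singularValues_sq_mul_le {T : V →ₗ[ℝ] V} (hT : T.IsSymmetric) {v : V}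
    (hv : v ∈ LinearMap.range T) :
    sInf {s : ℝ | s ≠ 0 ∧ ∃ i : ℕ, T.singularValues i = s} ^ 2 * ‖v‖ ^ 2 ≤ ‖T v‖ ^ 2 := by
  obtain ⟨p, rfl⟩ := hv
  rw [norm_sq_apply_eq_sum_singularValues T (T p),
    norm_sq_eq_sum_inner (T.isSymmetric_adjoint_comp_self.eigenvectorBasis rfl), Finset.mul_sum]
  refine Finset.sum_le_sum fun i _ => ?_
  by_cases hi : T.singularValues i = 0
  -- A zero singular value puts the basis vector in the kernel of `T`, so by symmetry a vector of
  -- the range has no component along it.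
  · have h0 : T (T.isSymmetric_adjoint_comp_self.eigenvectorBasis rfl i) = 0 := by
      have h := T.isSymmetric_adjoint_comp_self.apply_eigenvectorBasis rfl i
      rw [← T.sq_singularValues_fin rfl, hi] at h
      have h2 : LinearMap.adjoint T (T (T.isSymmetric_adjoint_comp_self.eigenvectorBasis rfl i))
          = 0 :=
        h.trans (by simp)
      rw [← inner_self_eq_zero (𝕜 := ℝ), ← LinearMap.adjoint_inner_right, h2, inner_zero_right]
    rw [← hT, h0, inner_zero_left]
    simp
  · refine mul_le_mul_of_nonneg_right (pow_le_pow_left₀ ?_ ?_ 2) (sq_nonneg _)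
    · exact Real.sInf_nonneg (by rintro s ⟨-, i, rfl⟩; exact T.singularValues_nonneg i)
    · exact csInf_le ⟨0, by rintro s ⟨-, i, rfl⟩; exact T.singularValues_nonneg i⟩ ⟨hi, i, rfl⟩

/-- The set is finite, so the infimum is attained once the set is nonempty. This is where `T ≠ 0`
matters: `sInf ∅ = 0`. -/
theorem sInf_singularValues_pos {T : V →ₗ[ℝ] W} (hT : T ≠ 0) :
    0 < sInf {s : ℝ | s ≠ 0 ∧ ∃ i : ℕ, T.singularValues i = s} := by
  have hne : {s : ℝ | s ≠ 0 ∧ ∃ i : ℕ, T.singularValues i = s}.Nonempty := by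
    by_contra hempty
    rw [Set.not_nonempty_iff_eq_empty] at hempty
    refine hT (T.singularValues_eq_zero_iff.1 (Finsupp.ext fun i => ?_))
    by_contra hi
    have : T.singularValues i ∈ {s : ℝ | s ≠ 0 ∧ ∃ i : ℕ, T.singularValues i = s} := ⟨hi, i, rfl⟩
    rw [hempty] at this
    exact this
  obtain ⟨h0, i, hi⟩ := hne.csInf_mem (setOf_singularValues_ne_zero_finite T)
  exact lt_of_le_of_ne (hi ▸ T.singularValues_nonneg i) h0.symm

theorem hasEigenvalue_toLin'_iff {n : Type*} [Fintype n] [DecidableEq n] (M : Matrix n n ℝ)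
    (t : ℝ) : Module.End.HasEigenvalue (Matrix.toLin' M) t ↔
      Module.End.HasEigenvalue (Matrix.toEuclideanLin M) t := by
  constructor <;> intro h <;> obtain ⟨v, hv⟩ := h.exists_hasEigenvector
  · refine Module.End.hasEigenvalue_of_hasEigenvector (x := WithLp.toLp 2 v) ⟨?_, ?_⟩
    · rw [Module.End.mem_eigenspace_iff, Matrix.toLpLin_toLp, hv.apply_eq_smul]; rfl
    · intro h0; exact hv.2 (by simpa using h0)
  · refine Module.End.hasEigenvalue_of_hasEigenvector (x := WithLp.ofLp v) ⟨?_, ?_⟩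
    · rw [Module.End.mem_eigenspace_iff, ← Matrix.ofLp_toLpLin, hv.apply_eq_smul]; rfl
    · intro h0; exact hv.2 (by simpa using h0)

theorem setOf_hasEigenvalue_eq {n : Type*} [Fintype n] [DecidableEq n] {M : Matrix n n ℝ}
    (hM : (Matrix.toEuclideanLin M).IsSymmetric) :
    {t : ℝ | Module.End.HasEigenvalue (Matrix.toLin' M) t} = Set.range (hM.eigenvalues rfl) := by
  ext t
  rw [Set.mem_ofPred_eq, hasEigenvalue_toLin'_iff]
  constructor
  · intro h
    obtain ⟨i, hi⟩ := hM.exists_eigenvalues_eq rfl h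
    exact ⟨i, hi⟩
  · rintro ⟨i, rfl⟩
    exact hM.hasEigenvalue_eigenvalues rfl i

theorem lambdaMin_mul_le {n : Type*} [Fintype n] [DecidableEq n] {M : Matrix n n ℝ}
    (hM : (Matrix.toEuclideanLin M).IsSymmetric) (v : EuclideanSpace ℝ n) :
    lambdaMin M * ‖v‖ ^ 2 ≤ inner ℝ v (Matrix.toEuclideanLin M v) := by
  rw [lambdaMin, setOf_hasEigenvalue_eq hM, hM.inner_apply_self_eq_sum rfl,
    norm_sq_eq_sum_inner (hM.eigenvectorBasis rfl), Finset.mul_sum]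
  exact Finset.sum_le_sum fun i _ => mul_le_mul_of_nonneg_right
    (csInf_le (Set.finite_range _).bddBelow ⟨i, rfl⟩) (sq_nonneg _)

theorem lambdaMin_pos {n : Type*} [Fintype n] [DecidableEq n] [Nonempty n] {M : Matrix n n ℝ}
    (hM : (Matrix.toEuclideanLin M).IsSymmetric)
    (hpos : ∀ v, v ≠ 0 → 0 < inner ℝ v (Matrix.toEuclideanLin M v)) : 0 < lambdaMin M := by
  have hne : (Set.range (hM.eigenvalues rfl)).Nonempty := by
    have : 0 < Module.finrank ℝ (EuclideanSpace ℝ n) := by simp [Fintype.card_pos]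
    exact ⟨_, ⟨0, this⟩, rfl⟩
  have hmem := hne.csInf_mem (Set.finite_range _)
  rw [lambdaMin, setOf_hasEigenvalue_eq hM]
  obtain ⟨i, hi⟩ := hmem
  rw [← hi]
  have h := hpos (hM.eigenvectorBasis rfl i) ((hM.eigenvectorBasis rfl).orthonormal.ne_zero i)
  rw [hM.apply_eigenvectorBasis, real_inner_smul_right, real_inner_self_eq_norm_sq,
    (hM.eigenvectorBasis rfl).orthonormal.1 i] at h
  simpa using h

end Spectral

/-! ### Transposes as adjoints. -/

section MatrixAdjoint

theorem inner_toEuclideanLin_transpose {m n : Type*} [Fintype m] [Fintype n] [DecidableEq m]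
    [DecidableEq n] (M : Matrix m n ℝ) (y : EuclideanSpace ℝ m) (w : EuclideanSpace ℝ n) :
    inner ℝ (Matrix.toEuclideanLin M.transpose y) w = inner ℝ y (Matrix.toEuclideanLin M w) := by
  rw [← Matrix.conjTranspose_eq_transpose_of_trivial, Matrix.toEuclideanLin_conjTranspose_eq_adjoint,
    LinearMap.adjoint_inner_left]

theorem toEuclideanLin_mul_apply {l m n : Type*} [Fintype l] [Fintype m] [Fintype n]
    [DecidableEq l] [DecidableEq m] [DecidableEq n] (M : Matrix l m ℝ) (N : Matrix m n ℝ)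
    (v : EuclideanSpace ℝ n) : Matrix.toEuclideanLin (M * N) v =
      Matrix.toEuclideanLin M (Matrix.toEuclideanLin N v) := by
  simp [Matrix.toLpLin_apply, Matrix.mulVec_mulVec]

theorem inner_toEuclideanLin_sq {n : Type*} [Fintype n] [DecidableEq n] {M : Matrix n n ℝ}
    (hM : M.IsSymm) (v : EuclideanSpace ℝ n) :
    inner ℝ v (Matrix.toEuclideanLin (M ^ 2) v) = ‖Matrix.toEuclideanLin M v‖ ^ 2 := by
  rw [pow_two, toEuclideanLin_mul_apply, ← inner_toEuclideanLin_transpose, hM.eq,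
    real_inner_self_eq_norm_sq]

theorem Matrix.IsSymm.isSymmetric_toEuclideanLin {n : Type*} [Fintype n] [DecidableEq n]
    {M : Matrix n n ℝ} (hM : M.IsSymm) : (Matrix.toEuclideanLin M).IsSymmetric := by
  rw [Matrix.isSymmetric_toEuclideanLin_iff, Matrix.IsHermitian,
    Matrix.conjTranspose_eq_transpose_of_trivial, hM.eq]

/-- The orthogonal complement of the range of `Mᵀ` lies in `ker M`, and in finite dimension a
subspace is its own double complement. -/
theorem mem_range_transpose {m n : Type*} [Fintype m] [Fintype n] [DecidableEq m]
    [DecidableEq n] (M : Matrix m n ℝ) {v : EuclideanSpace ℝ n}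
    (h : ∀ u, Matrix.toEuclideanLin M u = 0 → inner ℝ u v = 0) :
    ∃ y, Matrix.toEuclideanLin M.transpose y = v := by
  have : v ∈ (LinearMap.range (Matrix.toEuclideanLin M.transpose))ᗮᗮ := by
    rw [Submodule.mem_orthogonal]
    refine fun u hu => h u ?_
    rw [← inner_self_eq_zero (𝕜 := ℝ), ← inner_toEuclideanLin_transpose]
    exact Submodule.mem_orthogonal _ _ |>.1 hu _ ⟨_, rfl⟩
  rwa [Submodule.orthogonal_orthogonal] at this

end MatrixAdjoint

/-! ### Finite sums of extended reals. -/

section EReal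

theorem EReal.coe_finsetSum {ι : Type*} (s : Finset ι) (f : ι → ℝ) :
    ((∑ i ∈ s, f i : ℝ) : EReal) = ∑ i ∈ s, (f i : EReal) :=
  map_sum (⟨⟨Real.toEReal, EReal.coe_zero⟩, EReal.coe_add⟩ : ℝ →+ EReal) f s

theorem EReal.sum_ne_bot {ι : Type*} (s : Finset ι) {f : ι → EReal} (h : ∀ i, f i ≠ ⊥) :
    ∑ i ∈ s, f i ≠ ⊥ :=
  Finset.sum_induction f (· ≠ ⊥) (fun a b ha hb hab => by
    rcases EReal.add_eq_bot_iff.1 hab with h | h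
    exacts [ha h, hb h]) EReal.zero_ne_bot fun i _ => h i

theorem EReal.sum_eq_top {ι : Type*} {s : Finset ι} {f : ι → EReal} (h : ∀ i, f i ≠ ⊥) {i : ι}
    (hi : i ∈ s) (htop : f i = ⊤) : ∑ j ∈ s, f j = ⊤ := by
  classical
  rw [← Finset.add_sum_erase s f hi, htop, EReal.top_add_of_ne_bot (EReal.sum_ne_bot _ h)]

end EReal

/-! ### The averaged conjugate and consensual vectors. -/

section AvgConjugate

variable {K E : ℕ} {g : EuclideanSpace ℝ (Fin E) → EReal}

theorem avgConjugate_eq_of_forall_eq {y : Dual K E} {α : Fin K → ℝ}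
    (h : ∀ k, conjugate g (Dual.block y k) = α k) :
    avgConjugate g y = (1 / (K : ℝ) * ∑ k, α k : ℝ) := by
  rw [avgConjugate, EReal.coe_mul, EReal.coe_finsetSum]
  simp_rw [h]

theorem le_avgConjugate_of_forall_le {y : Dual K E} {α : Fin K → ℝ}
    (h : ∀ k, (α k : EReal) ≤ conjugate g (Dual.block y k)) :
    ((1 / (K : ℝ) * ∑ k, α k : ℝ) : EReal) ≤ avgConjugate g y := by
  rw [avgConjugate, EReal.coe_mul, EReal.coe_finsetSum]
  refine mul_le_mul_of_nonneg_left (Finset.sum_le_sum fun k _ => h k) ?_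
  exact_mod_cast (by positivity : (0 : ℝ) ≤ 1 / (K : ℝ))

theorem avgConjugate_le_of_forall_le {y : Dual K E} {α : Fin K → ℝ}
    (h : ∀ k, conjugate g (Dual.block y k) ≤ (α k : EReal)) :
    avgConjugate g y ≤ (1 / (K : ℝ) * ∑ k, α k : ℝ) := by
  rw [avgConjugate, EReal.coe_mul, EReal.coe_finsetSum]
  refine mul_le_mul_of_nonneg_left (Finset.sum_le_sum fun k _ => h k) ?_
  exact_mod_cast (by positivity : (0 : ℝ) ≤ 1 / (K : ℝ))

theorem avgConjugate_ne_bot (hg : IsProper g) (y : Dual K E) : avgConjugate g y ≠ ⊥ := by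
  obtain ⟨x, hx⟩ := hg.2
  obtain ⟨r, hr⟩ : ∃ r : ℝ, g x = r := by
    lift g x to ℝ using ⟨hx, hg.1 x⟩ with r hr
    exact ⟨r, rfl⟩
  exact ne_bot_of_le_ne_bot (EReal.coe_ne_bot _)
    (le_avgConjugate_of_forall_le fun k => inner_sub_le_conjugate hr (Dual.block y k))

theorem exists_conjugate_eq_coe (hK : 0 < K) (hg : IsProper g) {y : Dual K E} {a : ℝ}
    (h : avgConjugate g y = a) :
    ∃ α : Fin K → ℝ, (∀ k, conjugate g (Dual.block y k) = α k) ∧ a = 1 / (K : ℝ) * ∑ k, α k := by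
  have hne : ∀ k, conjugate g (Dual.block y k) ≠ ⊤ := by
    intro k hk
    rw [avgConjugate, EReal.sum_eq_top (fun k => conjugate_ne_bot hg (Dual.block y k))
      (Finset.mem_univ k) hk, EReal.coe_mul_top_of_pos (by positivity)] at h
    exact EReal.coe_ne_top a h.symm
  have hex : ∀ k, ∃ r : ℝ, conjugate g (Dual.block y k) = r := fun k => by
    lift conjugate g (Dual.block y k) to ℝ using ⟨hne k, conjugate_ne_bot hg _⟩ with r hr
    exact ⟨r, rfl⟩
  choose α hα using hex
  refine ⟨α, hα, ?_⟩
  rw [avgConjugate_eq_of_forall_eq hα] at h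
  exact_mod_cast h.symm

theorem Sharing.Dual.block_add (u v : Dual K E) (k : Fin K) :
    Dual.block (u + v) k = Dual.block u k + Dual.block v k := rfl

theorem Sharing.Dual.block_sub (u v : Dual K E) (k : Fin K) :
    Dual.block (u - v) k = Dual.block u k - Dual.block v k := rfl

theorem Sharing.Dual.block_smul (t : ℝ) (u : Dual K E) (k : Fin K) :
    Dual.block (t • u) k = t • Dual.block u k := rfl

theorem segmentConvex_avgConjugate (hK : 0 < K) (hg : IsProper g) :
    SegmentConvex (avgConjugate g : Dual K E → EReal) := by
  intro u v a b t hu hv h0 h1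
  obtain ⟨α, hα, rfl⟩ := exists_conjugate_eq_coe hK hg hu
  obtain ⟨β, hβ, rfl⟩ := exists_conjugate_eq_coe hK hg hv
  have h : avgConjugate g (u + t • (v - u)) ≤
      (1 / (K : ℝ) * ∑ k, ((1 - t) * α k + t * β k) : ℝ) := by
    refine avgConjugate_le_of_forall_le fun k => ?_
    rw [Dual.block_add, Dual.block_smul, Dual.block_sub]
    exact segmentConvex_conjugate hg _ _ (α k) (β k) t (hα k) (hβ k) h0 h1
  rw [Finset.sum_add_distrib, ← Finset.mul_sum, ← Finset.mul_sum] at h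
  convert! h using 2
  ring

theorem Sharing.Dual.sum_norm_sq_block (y : Dual K E) : ‖y‖ ^ 2 = ∑ k, ‖Dual.block y k‖ ^ 2 := by
  simp_rw [EuclideanSpace.real_norm_sq_eq, Fintype.sum_prod_type]
  rfl

/-- The consensual vector all of whose blocks equal `v`. -/
def Sharing.Dual.const (K : ℕ) (v : EuclideanSpace ℝ (Fin E)) : Dual K E :=
  WithLp.toLp 2 fun p => v p.2

@[simp]
theorem Sharing.Dual.block_const (v : EuclideanSpace ℝ (Fin E)) (k : Fin K) :
    Dual.block (Dual.const K v) k = v := rfl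

theorem Sharing.Dual.block_injective {y y' : Dual K E}
    (h : ∀ k, Dual.block y k = Dual.block y' k) : y = y' := by
  ext p
  exact congrArg (fun v : EuclideanSpace ℝ (Fin E) => v p.2) (h p.1)

theorem Sharing.Dual.inner_const (v : EuclideanSpace ℝ (Fin E)) (y : Dual K E) :
    inner ℝ (Dual.const K v) y = inner ℝ v (∑ k, Dual.block y k) := by
  rw [inner_sum]
  simp_rw [PiLp.inner_apply, Fintype.sum_prod_type]
  rfl

/-- Fenchel's equality for a subgradient. -/
theorem conjugate_eq_of_subgradient (hg : IsProper g) {x y : EuclideanSpace ℝ (Fin E)} {r : ℝ}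
    (hr : g x = r) (hy : ∀ (x' : EuclideanSpace ℝ (Fin E)) (s : ℝ), g x' = s →
      r + inner ℝ y (x' - x) ≤ s) :
    conjugate g y = (inner ℝ y x - r : ℝ) := by
  refine le_antisymm (conjugate_le_coe hg.1 fun x' s hs => ?_) (inner_sub_le_conjugate hr y)
  have := hy x' s hs
  rw [inner_sub_right] at this
  linarith

/-- The affine minorant `v ↦ ⟨v, x⟩ - r` of `g*` is tight at `y`, so `x` is a subgradient of `g*`
there. The factor `1/K` in `𝒢*` scales it to `x / K` in each block, whence the shift `(μ / K) • x`.
-/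
theorem isProx_avgConjugate_const (hK : 0 < K) (hg : IsProper g) {μ : ℝ} (hμ : 0 < μ)
    {x y : EuclideanSpace ℝ (Fin E)} {r : ℝ} (hr : g x = r)
    (hy : ∀ (x' : EuclideanSpace ℝ (Fin E)) (s : ℝ), g x' = s → r + inner ℝ y (x' - x) ≤ s) :
    IsProx μ (avgConjugate g) (Dual.const K (y + (μ / K) • x)) (Dual.const K y) := by
  intro v
  have hy' : avgConjugate g (Dual.const K y) = (1 / (K : ℝ) * ∑ _k : Fin K, (inner ℝ y x - r) : ℝ) :=
    avgConjugate_eq_of_forall_eq fun k => by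
      rw [Dual.block_const, conjugate_eq_of_subgradient hg hr hy]
  have hv : ((1 / (K : ℝ) * ∑ k, (inner ℝ (Dual.block v k) x - r) : ℝ) : EReal) ≤
      avgConjugate g v :=
    le_avgConjugate_of_forall_le fun k => inner_sub_le_conjugate hr (Dual.block v k)
  rw [hy']
  refine le_trans ?_ (add_le_add_left hv _)
  rw [← EReal.coe_add, ← EReal.coe_add, EReal.coe_le_coe_iff]
  rw [Dual.sum_norm_sq_block, Dual.sum_norm_sq_block, Finset.mul_sum, Finset.mul_sum,
    Finset.mul_sum, Finset.mul_sum, ← Finset.sum_add_distrib, ← Finset.sum_add_distrib]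
  refine Finset.sum_le_sum fun k _ => ?_
  have e1 : Dual.block (Dual.const K (y + (μ / K) • x) - Dual.const K y) k = (μ / K) • x := by
    rw [Dual.block_sub, Dual.block_const, Dual.block_const, add_sub_cancel_left]
  have e2 : Dual.block (Dual.const K (y + (μ / K) • x) - v) k
      = (μ / K) • x + (y - Dual.block v k) := by
    rw [Dual.block_sub, Dual.block_const]
    abel
  rw [e1, e2, norm_add_sq_real, real_inner_smul_left, inner_sub_right, real_inner_comm y x,
    real_inner_comm (Dual.block v k) x]
  have hK' : (0 : ℝ) < K := by exact_mod_cast hK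
  have h0 : 0 ≤ 1 / (2 * μ) * ‖y - Dual.block v k‖ ^ 2 := by positivity
  have e3 : 1 / (2 * μ) * (2 * (μ / K * (inner ℝ y x - inner ℝ (Dual.block v k) x)))
    = 1 / (K : ℝ) * (inner ℝ y x - inner ℝ (Dual.block v k) x) := by field_simp
  linarith

end AvgConjugate

/-! ### First-order optimality conditions. -/

section Optimality

variable {V : Type*} [NormedAddCommGroup V] [InnerProductSpace ℝ V]

theorem Sharing.IsConvex.segmentConvex {g : V → EReal} (hg : IsConvex g) : SegmentConvex g := by
  intro u v a b t hu hv h0 h1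
  have h := hg (x := (u, a)) (by simp [hu]) (y := (v, b)) (by simp [hv])
    (sub_nonneg.2 h1) h0 (by ring)
  have e : u + t • (v - u) = (1 - t) • u + t • v := by
    rw [smul_sub, sub_smul, one_smul]; abel
  rw [e]
  exact h

theorem le_inner_gradient_of_forall_le [CompleteSpace V] {f : V → ℝ} {G w d : V} {c : ℝ}
    (hf : HasGradientAt f G w) (h : ∀ t : ℝ, 0 < t → t ≤ 1 → f w + t * c ≤ f (w + t • d)) :
    c ≤ inner ℝ G d := by
  have hf' : HasGradientAt f G (w + (0 : ℝ) • d) := by simpa using hf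
  have hlim := hf'.hasDerivAt_comp_line.tendsto_slope_zero_right
  refine ge_of_tendsto hlim ?_
  filter_upwards [Ioc_mem_nhdsGT (zero_lt_one' ℝ)] with t ht
  have h1 := h t ht.1 ht.2
  simp only [zero_add, zero_smul, add_zero, smul_eq_mul]
  rw [← div_eq_inv_mul, le_div_iff₀ ht.1]
  linarith

/-- First-order optimality conditions for `f + g ∘ M` with `M` surjective. -/
theorem exists_subgradient_of_isMin {m n : Type*} [Fintype m] [Fintype n] [DecidableEq m]
    [DecidableEq n] {M : Matrix m n ℝ} (hM : Function.Surjective (Matrix.toEuclideanLin M))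
    {f : EuclideanSpace ℝ n → ℝ} {G w : EuclideanSpace ℝ n} (hf : HasGradientAt f G w)
    {g : EuclideanSpace ℝ m → EReal} (hg : IsProper g) (hconv : IsConvex g)
    (hmin : ∀ w', (f w : EReal) + g (Matrix.toEuclideanLin M w) ≤
      (f w' : EReal) + g (Matrix.toEuclideanLin M w')) :
    ∃ (y : EuclideanSpace ℝ m) (r : ℝ), g (Matrix.toEuclideanLin M w) = r ∧
      Matrix.toEuclideanLin M.transpose y = -G ∧
      ∀ (x : EuclideanSpace ℝ m) (s : ℝ), g x = s →
        r + inner ℝ y (x - Matrix.toEuclideanLin M w) ≤ s := by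
  obtain ⟨r, hr⟩ : ∃ r : ℝ, g (Matrix.toEuclideanLin M w) = r := by
    obtain ⟨x, hx⟩ := hg.2
    obtain ⟨w', rfl⟩ := hM x
    have hne : g (Matrix.toEuclideanLin M w) ≠ ⊤ := by
      intro htop
      have h := hmin w'
      rw [htop, EReal.coe_add_top, top_le_iff] at h
      exact EReal.add_ne_top (EReal.coe_ne_top _) hx h
    lift g (Matrix.toEuclideanLin M w) to ℝ using ⟨hne, hg.1 _⟩ with r hr
    exact ⟨r, rfl⟩
  -- Moving along `ker M` leaves the `g` term unchanged, so `G` is orthogonal to `ker M` and `-G` is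
  -- in the range of `Mᵀ`.
  have hker : ∀ u, Matrix.toEuclideanLin M u = 0 → 0 ≤ inner ℝ G u := by
    intro u hu
    refine le_inner_gradient_of_forall_le hf fun t _ _ => ?_
    have h := hmin (w + t • u)
    rw [map_add, map_smul, hu, smul_zero, add_zero, hr] at h
    norm_cast at h
    linarith
  obtain ⟨y, hy⟩ := mem_range_transpose M (v := -G) fun u hu => by
    have h1 := hker u hu
    have h2 := hker (-u) (by rw [map_neg, hu, neg_zero])
    rw [inner_neg_right] at h2
    rw [inner_neg_right, real_inner_comm]
    linarith
  refine ⟨y, r, hr, hy, fun x s hs => ?_⟩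
  obtain ⟨w', rfl⟩ := hM x
  -- Minimality on the segment to a preimage `w'` of `x`, with convexity of `g`, bounds the
  -- directional derivative.
  have h : r - s ≤ inner ℝ G (w' - w) := by
    refine le_inner_gradient_of_forall_le hf fun t h0 h1 => ?_
    have h2 := hmin (w + t • (w' - w))
    rw [map_add, map_smul, map_sub, hr] at h2
    have h3 := h2.trans (add_le_add_right
      (hconv.segmentConvex _ _ r s t hr hs h0.le h1) _)
    norm_cast at h3
    linarith
  have h2 : inner ℝ y (Matrix.toEuclideanLin M w' - Matrix.toEuclideanLin M w)
      = - inner ℝ G (w' - w) := by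
    rw [← map_sub, ← inner_toEuclideanLin_transpose, hy, inner_neg_left]
  rw [h2]
  linarith

end Optimality

/-! ### Block structure and surjectivity of `B` and `𝓑_d`. -/

section Blocks

variable {K E : ℕ} {Q : Fin K → ℕ} (B : (k : Fin K) → Matrix (Fin E) (Fin (Q k)) ℝ)

theorem block_toEuclideanLin_blockDiag (w : Primal K Q) (k : Fin K) :
    Dual.block (Matrix.toEuclideanLin (blockDiag B) w) k =
      Matrix.toEuclideanLin (B k) (Primal.block w k) := by
  ext e
  simp only [Dual.block, Primal.block, Matrix.toLpLin_apply, Matrix.mulVec, dotProduct, blockDiag,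
    Matrix.of_apply, Fintype.sum_sigma, ite_mul, zero_mul]
  rw [Finset.sum_eq_single k]
  · simp
  · intro l _ hl
    simp [hl.symm]
  · simp

theorem toEuclideanLin_rowConcat (w : Primal K Q) :
    Matrix.toEuclideanLin (rowConcat B) w =
      ∑ k, Dual.block (Matrix.toEuclideanLin (blockDiag B) w) k := by
  simp_rw [block_toEuclideanLin_blockDiag]
  ext e
  simp [Primal.block, Matrix.toLpLin_apply, Matrix.mulVec, dotProduct, rowConcat,
    Fintype.sum_sigma]

theorem toEuclideanLin_blockDiag_transpose_const (v : EuclideanSpace ℝ (Fin E)) :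
    Matrix.toEuclideanLin (blockDiag B).transpose (Dual.const K v) =
      Matrix.toEuclideanLin (rowConcat B).transpose v := by
  refine ext_inner_right ℝ fun w => ?_
  rw [inner_toEuclideanLin_transpose, inner_toEuclideanLin_transpose, Dual.inner_const,
    toEuclideanLin_rowConcat]

theorem toEuclideanLin_surjective_of_rank {m n : ℕ} {M : Matrix (Fin m) (Fin n) ℝ}
    (hM : M.rank = m) : Function.Surjective (Matrix.toEuclideanLin M) := by
  have h : LinearMap.range M.mulVecLin = ⊤ := by
    apply Submodule.eq_top_of_finrank_eq
    rw [← Matrix.rank, hM, Module.finrank_fin_fun]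
  intro y
  obtain ⟨x, hx⟩ := LinearMap.range_eq_top.1 h (WithLp.ofLp y)
  exact ⟨WithLp.toLp 2 x, by rw [Matrix.toLpLin_apply]; exact congrArg (WithLp.toLp 2) hx⟩

variable {B}

theorem toEuclideanLin_blockDiag_surjective (hB : ∀ k, (B k).rank = E) :
    Function.Surjective (Matrix.toEuclideanLin (blockDiag B)) := by
  intro y
  choose u hu using fun k => toEuclideanLin_surjective_of_rank (hB k) (Dual.block y k)
  refine ⟨WithLp.toLp 2 fun q => u q.1 q.2, Dual.block_injective fun k => ?_⟩
  rw [block_toEuclideanLin_blockDiag, ← hu k]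
  rfl

theorem toEuclideanLin_rowConcat_surjective (hK : 0 < K) (hB : ∀ k, (B k).rank = E) :
    Function.Surjective (Matrix.toEuclideanLin (rowConcat B)) := by
  intro x
  obtain ⟨w, hw⟩ := toEuclideanLin_blockDiag_surjective hB (Dual.const K ((1 / (K : ℝ)) • x))
  refine ⟨w, ?_⟩
  rw [toEuclideanLin_rowConcat, hw]
  have hK' : (K : ℝ) ≠ 0 := by exact_mod_cast hK.ne'
  simp only [Dual.block_const, Finset.sum_const, Finset.card_univ, Fintype.card_fin]
  rw [← Nat.cast_smul_eq_nsmul ℝ, smul_smul, mul_one_div_cancel hK', one_smul]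

theorem toEuclideanLin_blockDiag_transpose_eq_zero (hB : ∀ k, (B k).rank = E) {y : Dual K E}
    (hy : Matrix.toEuclideanLin (blockDiag B).transpose y = 0) : y = 0 := by
  obtain ⟨w, hw⟩ := toEuclideanLin_blockDiag_surjective hB y
  rw [← inner_self_eq_zero (𝕜 := ℝ)]
  nth_rw 2 [← hw]
  rw [← inner_toEuclideanLin_transpose, hy, inner_zero_left]

theorem kronId_const {A : Matrix (Fin K) (Fin K) ℝ} (hA : ∀ i, ∑ j, A i j = 1)
    (v : EuclideanSpace ℝ (Fin E)) :
    Matrix.toEuclideanLin (kronId E A) (Dual.const K v) = Dual.const K v := by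
  ext p
  simp only [Matrix.toLpLin_apply, Matrix.mulVec, dotProduct, kronId, Dual.const,
    Fintype.sum_prod_type, Matrix.kronecker, Matrix.kroneckerMap_apply, Matrix.one_apply]
  simp [← Finset.sum_mul, hA]

end Blocks

/-! ### The two energy identities. -/

section Identities

variable {V W : Type*} [NormedAddCommGroup V] [InnerProductSpace ℝ V]
  [NormedAddCommGroup W] [InnerProductSpace ℝ W]

/-- With `u = w + μw • T' y`, the weight `μy / μw` makes the cross term of `‖u‖²` equal to that of
`‖y + μy • T w‖²`. The dual step must use the new `w`. -/
theorem primal_energy_identity {T : V →ₗ[ℝ] W} {T' : W →ₗ[ℝ] V}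
    (hT : ∀ y w, inner ℝ (T' y) w = inner ℝ y (T w)) {μw μy : ℝ} (hμw : μw ≠ 0) {u w : V} {y : W}
    (hw : w = u - μw • T' y) :
    μy / μw * (‖w‖ ^ 2 - μw * μy * ‖T w‖ ^ 2) + ‖y + μy • T w‖ ^ 2 =
      μy / μw * ‖u‖ ^ 2 + (‖y‖ ^ 2 - μw * μy * ‖T' y‖ ^ 2) := by
  obtain rfl : u = w + μw • T' y := by rw [hw, sub_add_cancel]
  rw [norm_add_sq_real, norm_add_sq_real, real_inner_smul_right, real_inner_smul_right,
    norm_smul, norm_smul, mul_pow, mul_pow, Real.norm_eq_abs, Real.norm_eq_abs, sq_abs, sq_abs,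
    real_inner_comm (T' y) w, hT]
  field_simp
  ring

/-- By symmetry `⟨x, L z⟩ = ⟨L x, a + L x⟩`, so the cross terms of `‖z‖²` and `‖x'‖²` combine into
`-‖L x‖²`. -/
theorem dual_energy_identity {L : V →ₗ[ℝ] V} (hL : L.IsSymmetric) {a x x' z : V}
    (hz : z = a + L x) (hx : x' = x - L z) :
    ‖z‖ ^ 2 - ‖L z‖ ^ 2 + ‖x'‖ ^ 2 = ‖a‖ ^ 2 + (‖x‖ ^ 2 - ‖L x‖ ^ 2) := by
  have h1 : inner ℝ x (L z) = inner ℝ a (L x) + ‖L x‖ ^ 2 := by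
    rw [← hL, hz, inner_add_right, real_inner_self_eq_norm_sq, real_inner_comm]
  have h2 : ‖z‖ ^ 2 = ‖a‖ ^ 2 + 2 * inner ℝ a (L x) + ‖L x‖ ^ 2 := by
    rw [hz, norm_add_sq_real]
  rw [hx, norm_sub_sq_real, h1, h2]
  ring

end Identities

/-! ### Consequences of the combination assumption. -/

section Combination

variable {K E : ℕ} {A : Matrix (Fin K) (Fin K) ℝ} {L : Matrix (Fin K × Fin E) (Fin K × Fin E) ℝ}

theorem kronId_isSymm (hA : A.IsSymm) : (kronId E A).IsSymm := by
  ext i j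
  simp only [kronId, Matrix.kronecker, Matrix.transpose_apply, Matrix.kroneckerMap_apply,
    hA.apply i.1 j.1, Matrix.one_apply, eq_comm]

theorem Sharing.CombinationAssumption.norm_sq_kronId_le (h : CombinationAssumption A L)
    (z : Dual K E) :
    ‖Matrix.toEuclideanLin (kronId E A) z‖ ^ 2 ≤
      ‖z‖ ^ 2 - ‖Matrix.toEuclideanLin L z‖ ^ 2 := by
  have h1 := (Matrix.isPositive_toEuclideanLin_iff.2 h.le).re_inner_nonneg_right z
  have e1 : Matrix.toEuclideanLin (1 : Matrix (Fin K × Fin E) (Fin K × Fin E) ℝ) z = z := by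
    simp
  rw [map_sub, map_sub, LinearMap.sub_apply, LinearMap.sub_apply, inner_sub_right,
    inner_sub_right, inner_toEuclideanLin_sq h.symm_L,
    inner_toEuclideanLin_sq (kronId_isSymm h.symm), e1, real_inner_self_eq_norm_sq] at h1
  simp only [RCLike.re_to_real] at h1
  linarith

theorem Sharing.CombinationAssumption.toEuclideanLin_const (h : CombinationAssumption A L)
    (v : EuclideanSpace ℝ (Fin E)) : Matrix.toEuclideanLin L (Dual.const K v) = 0 :=
  (h.consensus _).2 fun _ _ => rfl

theorem Sharing.CombinationAssumption.toEuclideanLin_ne_zero (hK : 2 ≤ K) (hE : 1 ≤ E)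
    (h : CombinationAssumption A L) : Matrix.toEuclideanLin L ≠ 0 := by
  intro h0
  have h1 := (h.consensus (WithLp.toLp 2 fun p => if p.1 = ⟨0, by omega⟩ then 1 else 0)).1
    (by rw [h0, LinearMap.zero_apply]) ⟨0, by omega⟩ ⟨1, by omega⟩
  have h2 := congrArg (fun v : EuclideanSpace ℝ (Fin E) => v ⟨0, by omega⟩) h1
  simp [Dual.block] at h2

theorem Sharing.CombinationAssumption.sigmaMinNonzero_pos (hK : 2 ≤ K) (hE : 1 ≤ E)
    (h : CombinationAssumption A L) : 0 < sigmaMinNonzero L :=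
  sInf_singularValues_pos (h.toEuclideanLin_ne_zero hK hE)

/-- A vector whose blocks sum to zero lies in the range of `L`. -/
theorem Sharing.CombinationAssumption.exists_eq_of_sum_block_eq_zero (hK : 0 < K)
    (h : CombinationAssumption A L) {v : Dual K E} (hv : ∑ k, Dual.block v k = 0) :
    ∃ x, Matrix.toEuclideanLin L x = v := by
  rw [← h.symm_L.eq]
  refine mem_range_transpose L fun u hu => ?_
  have hu' : u = Dual.const K (Dual.block u ⟨0, hK⟩) :=
    Dual.block_injective fun k => (h.consensus u).1 hu _ _
  rw [hu', Dual.inner_const, hv, inner_zero_right]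

end Combination

/-! ### Spectral bounds and step sizes entering the rate. -/

section Rate

variable {K E : ℕ} {Q : Fin K → ℕ} {B : (k : Fin K) → Matrix (Fin E) (Fin (Q k)) ℝ}

theorem norm_sq_le_sigmaMax {m n : Type*} [Fintype m] [Fintype n] [DecidableEq m] [DecidableEq n]
    (M : Matrix m n ℝ) (w : EuclideanSpace ℝ n) :
    ‖Matrix.toEuclideanLin M w‖ ^ 2 ≤ sigmaMax M ^ 2 * ‖w‖ ^ 2 :=
  norm_sq_apply_le_singularValues_zero _ w

theorem inner_mul_transpose_self {m n : Type*} [Fintype m] [Fintype n] [DecidableEq m]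
    [DecidableEq n] (M : Matrix m n ℝ) (y : EuclideanSpace ℝ m) :
    inner ℝ y (Matrix.toEuclideanLin (M * M.transpose) y) =
      ‖Matrix.toEuclideanLin M.transpose y‖ ^ 2 := by
  rw [toEuclideanLin_mul_apply, ← inner_toEuclideanLin_transpose, real_inner_self_eq_norm_sq]

theorem isSymmetric_toEuclideanLin_mul_transpose {m n : Type*} [Fintype m] [Fintype n]
    [DecidableEq m] [DecidableEq n] (M : Matrix m n ℝ) :
    (Matrix.toEuclideanLin (M * M.transpose)).IsSymmetric := by
  have h : (M * M.transpose).IsSymm := by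
    rw [Matrix.IsSymm, Matrix.transpose_mul, Matrix.transpose_transpose]
  exact h.isSymmetric_toEuclideanLin

theorem lambdaMin_mul_transpose_le {m n : Type*} [Fintype m] [Fintype n] [DecidableEq m]
    [DecidableEq n] (M : Matrix m n ℝ) (y : EuclideanSpace ℝ m) :
    lambdaMin (M * M.transpose) * ‖y‖ ^ 2 ≤ ‖Matrix.toEuclideanLin M.transpose y‖ ^ 2 := by
  rw [← inner_mul_transpose_self]
  exact lambdaMin_mul_le (isSymmetric_toEuclideanLin_mul_transpose M) y

theorem lambdaMin_blockDiag_pos (hK : 2 ≤ K) (hE : 1 ≤ E) (hB : ∀ k, (B k).rank = E) :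
    0 < lambdaMin (blockDiag B * (blockDiag B).transpose) := by
  have : Nonempty (Fin K × Fin E) := ⟨(⟨0, by omega⟩, ⟨0, by omega⟩)⟩
  refine lambdaMin_pos (isSymmetric_toEuclideanLin_mul_transpose (blockDiag B))
    fun v hv => ?_
  rw [inner_mul_transpose_self]
  have : Matrix.toEuclideanLin (blockDiag B).transpose v ≠ 0 := fun h =>
    hv (toEuclideanLin_blockDiag_transpose_eq_zero hB h)
  positivity

theorem mul_sq_lt_of_lt_div {δ ν μw μy σ : ℝ} (hν : 0 < ν) (hνδ : ν ≤ δ)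
    (hμw : 0 < μw) (hμy : 0 < μy) (hμy_lt : μy < 2 * δ * ν / ((δ + ν) * σ ^ 2)) :
    μy * μw * σ ^ 2 < 2 * μw * δ * ν / (δ + ν) := by
  have hpos : 0 < δ + ν := by linarith
  have hσ : 0 < σ ^ 2 := by
    -- For `σ = 0` the bound on `μy` is a division by zero, with value `0`, contradicting `0 < μy`.
    refine lt_of_le_of_ne (sq_nonneg σ) fun h => ?_
    rw [← h] at hμy_lt
    simp at hμy_lt
    linarith
  rw [lt_div_iff₀ (by positivity)] at hμy_lt
  rw [lt_div_iff₀ hpos]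
  nlinarith

/-- This is `4δν ≤ (δ + ν)²`; it makes the first entry of `γ` nonnegative, hence `γ` too. -/
theorem two_mul_div_add_le_one {δ ν μw : ℝ} (hν : 0 < ν) (hνδ : ν ≤ δ)
    (hμw_le : μw ≤ 2 / (δ + ν)) : 2 * μw * δ * ν / (δ + ν) ≤ 1 := by
  have hpos : 0 < δ + ν := by linarith
  have hδν : 0 < δ * ν := mul_pos (by linarith) hν
  rw [le_div_iff₀ hpos] at hμw_le
  rw [div_le_one hpos]
  by_contra! h
  nlinarith [sq_nonneg (δ - ν), mul_le_mul_of_nonneg_right hμw_le hδν.le,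
    mul_lt_mul_of_pos_right h hpos]

end Rate

/-! ### Fixed points and the one-step contraction. -/

section Algorithm

variable {K E : ℕ} {Q : Fin K → ℕ}
  {J : (k : Fin K) → EuclideanSpace ℝ (Fin (Q k)) → ℝ}
  {g : EuclideanSpace ℝ (Fin E) → EReal}
  {B : (k : Fin K) → Matrix (Fin E) (Fin (Q k)) ℝ}
  {A : Matrix (Fin K) (Fin K) ℝ}
  {L : Matrix (Fin K × Fin E) (Fin K × Fin E) ℝ}
  {δ ν μw μy : ℝ}

theorem Sharing.ObjectiveAssumption.exists_subgradient (hK : 0 < K)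
    (hobj : ObjectiveAssumption J g B δ ν) (hB : ∀ k, (B k).rank = E) :
    ∃ (w : Primal K Q) (y : EuclideanSpace ℝ (Fin E)) (r : ℝ),
      g (Matrix.toEuclideanLin (rowConcat B) w) = r ∧
      Matrix.toEuclideanLin (rowConcat B).transpose y = - gradient (totalCost J) w ∧
      ∀ (x : EuclideanSpace ℝ (Fin E)) (s : ℝ), g x = s →
        r + inner ℝ y (x - Matrix.toEuclideanLin (rowConcat B) w) ≤ s := by
  obtain ⟨w, hw⟩ := hobj.exists_solution
  exact ⟨w, exists_subgradient_of_isMin (toEuclideanLin_rowConcat_surjective hK hB)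
    ((hobj.smooth.1 w).hasGradientAt) hobj.proper hobj.convex hw⟩

theorem Sharing.ObjectiveAssumption.exists_avgConjugate_ne_top (hK : 0 < K)
    (hobj : ObjectiveAssumption J g B δ ν) (hB : ∀ k, (B k).rank = E) :
    ∃ v : Dual K E, avgConjugate g v ≠ ⊤ := by
  obtain ⟨w, y, r, hr, -, hsub⟩ := hobj.exists_subgradient hK hB
  refine ⟨Dual.const K y, ?_⟩
  rw [avgConjugate_eq_of_forall_eq (α := fun _ =>
    inner ℝ y (Matrix.toEuclideanLin (rowConcat B) w) - r) fun k => by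
      rw [Dual.block_const, conjugate_eq_of_subgradient hobj.proper hr hsub]]
  exact EReal.coe_ne_top _

theorem exists_isFixedPoint (hK : 2 ≤ K) (hobj : ObjectiveAssumption J g B δ ν)
    (hcomb : CombinationAssumption A L) (hB : ∀ k, (B k).rank = E) (hμy : 0 < μy) :
    ∃ (wo : Primal K Q) (xo yo zo : Dual K E), IsFixedPoint J g B A L μy wo xo yo zo := by
  have hK0 : 0 < K := by omega
  have hK' : (K : ℝ) ≠ 0 := by positivity
  obtain ⟨w, y, r, hr, hy, hsub⟩ := hobj.exists_subgradient hK0 hB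
  set x₀ := Matrix.toEuclideanLin (rowConcat B) w with hx₀
  set zo : Dual K E := Dual.const K (y + (μy / K) • x₀) with hzo
  -- The blocks sum to `μy • x₀ - μy • B w = 0`; the weight `μy / K` in `zo` is what balances them.
  obtain ⟨xo, hxo⟩ := hcomb.exists_eq_of_sum_block_eq_zero hK0
    (v := zo - Dual.const K y - μy • Matrix.toEuclideanLin (blockDiag B) w) (by
      have hblock : ∀ k, Dual.block
          (zo - Dual.const K y - μy • Matrix.toEuclideanLin (blockDiag B) w) k =
          (μy / K) • x₀ - μy • Dual.block (Matrix.toEuclideanLin (blockDiag B) w) k := by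
        intro k
        rw [Dual.block_sub, Dual.block_sub, Dual.block_smul, hzo, Dual.block_const,
          Dual.block_const, add_sub_cancel_left]
      simp_rw [hblock]
      rw [Finset.sum_sub_distrib, ← Finset.smul_sum (r := μy), ← toEuclideanLin_rowConcat, ← hx₀,
        Finset.sum_const, Finset.card_univ, Fintype.card_fin, ← Nat.cast_smul_eq_nsmul ℝ,
        smul_smul, mul_div_cancel₀ _ hK', sub_self])
  refine ⟨w, xo, Dual.const K y, zo, ?_, ?_, ?_, ?_⟩
  · rw [toEuclideanLin_blockDiag_transpose_const, hy, add_neg_cancel]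
  · rw [hxo]; abel
  · exact (hcomb.toEuclideanLin_const _).symm
  · rw [hzo, kronId_const fun i => sum_row_of_mem_doublyStochastic hcomb.doublyStochastic i]
    exact isProx_avgConjugate_const hK0 hobj.proper hμy hr hsub

theorem Sharing.IsRun.mem_range {w : ℕ → Primal K Q} {z x y : ℕ → Dual K E}
    (h : IsRun J g B A L μw μy w z x y) (i : ℕ) :
    x i ∈ LinearMap.range (Matrix.toEuclideanLin L) := by
  induction i with
  | zero => rw [h.init]; exact Submodule.zero_mem _
  | succ i ih => rw [h.x_step]; exact Submodule.sub_mem _ ih ⟨_, rfl⟩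

/-- One step of the algorithm contracts the weighted squared distance to a fixed point. -/
theorem Sharing.IsRun.energy_succ_le (hK : 2 ≤ K)
    (hobj : ObjectiveAssumption J g B δ ν)
    (hcomb : CombinationAssumption A L) (hB : ∀ k, (B k).rank = E)
    (hμw : 0 < μw) (hμy : 0 < μy) (hμw_le : μw ≤ 2 / (δ + ν))
    (hlt : μy * μw * sigmaMax (blockDiag B) ^ 2 < 1)
    {wo : Primal K Q} {xo yo zo : Dual K E} (hfix : IsFixedPoint J g B A L μy wo xo yo zo)
    (hxo : xo ∈ LinearMap.range (Matrix.toEuclideanLin L))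
    {w : ℕ → Primal K Q} {z x y : ℕ → Dual K E} (hrun : IsRun J g B A L μw μy w z x y) (i : ℕ) :
    μy / μw * (1 - μy * μw * sigmaMax (blockDiag B) ^ 2) * ‖w (i + 1) - wo‖ ^ 2
        + ‖y (i + 1) - yo‖ ^ 2 + ‖x (i + 1) - xo‖ ^ 2 ≤
      rate B L δ ν μw μy *
        (μy / μw * (1 - μy * μw * sigmaMax (blockDiag B) ^ 2) * ‖w i - wo‖ ^ 2
          + ‖y i - yo‖ ^ 2 + ‖x i - xo‖ ^ 2) := by
  have hstep := norm_sq_gradient_step_le hobj.nu_pos hobj.nu_le_delta hobj.smooth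
    hobj.stronglyConvex hμw hμw_le (w i) wo
  -- Here `u` is the error after the pure gradient step, the quantity bounded by `hstep`.
  have hprimal := primal_energy_identity (T := Matrix.toEuclideanLin (blockDiag B))
    (inner_toEuclideanLin_transpose (blockDiag B)) (μy := μy) hμw.ne'
    (u := (w i - wo) - μw • (gradient (totalCost J) (w i) - gradient (totalCost J) wo))
    (w := w (i + 1) - wo) (y := y i - yo) (by
      have h0 : gradient (totalCost J) wo =
          - Matrix.toEuclideanLin (blockDiag B).transpose yo :=
        eq_neg_of_add_eq_zero_left hfix.w_eq.symm
      rw [hrun.w_step, h0, map_sub, smul_sub, smul_sub, smul_neg]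
      abel)
  have hdual := dual_energy_identity hcomb.symm_L.isSymmetric_toEuclideanLin
    (a := (y i - yo) + μy • Matrix.toEuclideanLin (blockDiag B) (w (i + 1) - wo))
    (x := x i - xo) (x' := x (i + 1) - xo) (z := z (i + 1) - zo)
    (by
      rw [hrun.z_step, map_sub, map_sub, smul_sub]
      nth_rw 1 [hfix.z_eq]
      abel)
    (by
      rw [hrun.x_step, map_sub, ← hfix.x_eq]
      abel)
  have hprox : ‖y (i + 1) - yo‖ ^ 2 ≤
      ‖z (i + 1) - zo‖ ^ 2 - ‖Matrix.toEuclideanLin L (z (i + 1) - zo)‖ ^ 2 := by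
    refine le_trans (pow_le_pow_left₀ (norm_nonneg _) ?_ 2)
      (hcomb.norm_sq_kronId_le (z (i + 1) - zo))
    rw [map_sub]
    refine IsProx.norm_sub_le hμy (avgConjugate_ne_bot hobj.proper) ?_
      (segmentConvex_avgConjugate (by omega) hobj.proper) (hrun.y_step i) hfix.y_eq
    exact hobj.exists_avgConjugate_ne_top (by omega) hB
  have hsig := norm_sq_le_sigmaMax (blockDiag B) (w (i + 1) - wo)
  have hlam := lambdaMin_mul_transpose_le (blockDiag B) (y i - yo)
  have hmin : sigmaMinNonzero L ^ 2 * ‖x i - xo‖ ^ 2 ≤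
      ‖Matrix.toEuclideanLin L (x i - xo)‖ ^ 2 :=
    sInf_singularValues_sq_mul_le hcomb.symm_L.isSymmetric_toEuclideanLin
      (Submodule.sub_mem _ (hrun.mem_range i) hxo)
  set γ := rate B L δ ν μw μy
  have hγ1 : (1 - 2 * μw * δ * ν / (δ + ν)) / (1 - μy * μw * sigmaMax (blockDiag B) ^ 2) ≤ γ :=
    (le_max_left _ _).trans (le_max_left _ _)
  have hγ2 : 1 - μw * μy * lambdaMin (blockDiag B * (blockDiag B).transpose) ≤ γ :=
    (le_max_right _ _).trans (le_max_left _ _)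
  have hγ3 : 1 - sigmaMinNonzero L ^ 2 ≤ γ := le_max_right _ _
  rw [div_le_iff₀ (by linarith)] at hγ1
  have hc : 0 < μy / μw := by positivity
  have hm : 0 < μw * μy := by positivity
  -- `k1`, `k2` and `k3` insert `γ` for the errors in `w`, `y` and `x`; `k4` and `k5` weight the
  -- spectral bounds as in `hprimal`. `k5` is what lowers the weight of the new `w` error from `μy /
  -- μw` to `c`.
  have k1 := mul_le_mul_of_nonneg_left
    (hstep.trans (mul_le_mul_of_nonneg_right hγ1 (sq_nonneg ‖w i - wo‖))) hc.le
  have k2 := mul_le_mul_of_nonneg_right hγ2 (sq_nonneg ‖y i - yo‖)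
  have k3 := mul_le_mul_of_nonneg_right hγ3 (sq_nonneg ‖x i - xo‖)
  have k4 := mul_le_mul_of_nonneg_left hlam hm.le
  have k5 := mul_le_mul_of_nonneg_left (mul_le_mul_of_nonneg_left hsig hm.le) hc.le
  linarith

end Algorithm

theorem theorem1 (K E : ℕ) (hK : 2 ≤ K) (hE : 1 ≤ E) (Q : Fin K → ℕ)
    (J : (k : Fin K) → EuclideanSpace ℝ (Fin (Q k)) → ℝ)
    (g : EuclideanSpace ℝ (Fin E) → EReal)
    (B : (k : Fin K) → Matrix (Fin E) (Fin (Q k)) ℝ)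
    (A : Matrix (Fin K) (Fin K) ℝ)
    (L : Matrix (Fin K × Fin E) (Fin K × Fin E) ℝ)
    (δ ν μw μy : ℝ)
    (hobj : ObjectiveAssumption J g B δ ν)
    (hcomb : CombinationAssumption A L)
    (hB : ∀ k, (B k).rank = E)
    (hμw : 0 < μw) (hμy : 0 < μy)
    (hμw_le : μw ≤ 2 / (δ + ν))
    (hμy_lt : μy < 2 * δ * ν / ((δ + ν) * sigmaMax (blockDiag B) ^ 2)) :
    (∃ (wo : Primal K Q) (xo yo zo : Dual K E), IsFixedPoint J g B A L μy wo xo yo zo) ∧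
    rate B L δ ν μw μy < 1 ∧
    ∀ (wo : Primal K Q) (xo yo zo : Dual K E), IsFixedPoint J g B A L μy wo xo yo zo →
      ∀ (w : ℕ → Primal K Q) (z x y : ℕ → Dual K E), IsRun J g B A L μw μy w z x y →
        ∃ C : ℝ, 0 ≤ C ∧ ∀ i : ℕ, ‖w (i + 1) - wo‖ ^ 2 ≤ rate B L δ ν μw μy ^ i * C := by
  have hlt := mul_sq_lt_of_lt_div hobj.nu_pos hobj.nu_le_delta hμw hμy hμy_lt
  have hle := two_mul_div_add_le_one hobj.nu_pos hobj.nu_le_delta hμw_le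
  have hpos : 0 < 1 - μy * μw * sigmaMax (blockDiag B) ^ 2 := by linarith
  have hlam := lambdaMin_blockDiag_pos hK hE hB
  have hsig := hcomb.sigmaMinNonzero_pos hK hE
  refine ⟨exists_isFixedPoint hK hobj hcomb hB hμy, ?_, ?_⟩
  · refine max_lt (max_lt ?_ ?_) ?_
    · rw [div_lt_one hpos]; linarith
    · have : 0 < μw * μy * lambdaMin (blockDiag B * (blockDiag B).transpose) := by positivity
      linarith
    · have : 0 < sigmaMinNonzero L ^ 2 := by positivity
      linarith
  · intro wo xo yo zo hfix w z x y hrun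
    have hγ0 : 0 ≤ rate B L δ ν μw μy :=
      (div_nonneg (by linarith) hpos.le).trans ((le_max_left _ _).trans (le_max_left _ _))
    -- The component of `xo` orthogonal to the range lies in `ker L`; dropping it keeps a fixed
    -- point.
    obtain ⟨x₁, hx₁, x₂, hx₂, hxo⟩ :=
      (LinearMap.range (Matrix.toEuclideanLin L)).exists_add_mem_mem_orthogonal xo
    have hx₂' : Matrix.toEuclideanLin L x₂ = 0 := by
      rwa [hcomb.symm_L.isSymmetric_toEuclideanLin.orthogonal_range, LinearMap.mem_ker] at hx₂
    have hfix' : IsFixedPoint J g B A L μy wo x₁ yo zo :=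
      ⟨hfix.w_eq, by
        have h := hfix.z_eq
        rwa [hxo, map_add, hx₂', add_zero] at h, hfix.x_eq, hfix.y_eq⟩
    have hc : 0 < μy / μw * (1 - μy * μw * sigmaMax (blockDiag B) ^ 2) := by positivity
    set c := μy / μw * (1 - μy * μw * sigmaMax (blockDiag B) ^ 2) with hcdef
    set V : ℕ → ℝ := fun i => c * ‖w i - wo‖ ^ 2 + ‖y i - yo‖ ^ 2 + ‖x i - x₁‖ ^ 2 with hV
    -- Index `1` is iterate number `0`, so counting from `V 1` gives exactly the power `γ ^ i`.
    have hV0 : 0 ≤ V 1 := by positivity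
    have hdec : ∀ i, V (i + 1) ≤ rate B L δ ν μw μy ^ i * V 1 := by
      intro i
      induction i with
      | zero => simp
      | succ i ih =>
        have h := hrun.energy_succ_le hK hobj hcomb hB hμw hμy hμw_le (by linarith) hfix' hx₁
          (i + 1)
        calc V (i + 1 + 1) ≤ rate B L δ ν μw μy * V (i + 1) := h
          _ ≤ rate B L δ ν μw μy * (rate B L δ ν μw μy ^ i * V 1) :=
            mul_le_mul_of_nonneg_left ih hγ0
          _ = _ := by ring
    refine ⟨V 1 / c, by positivity, fun i => ?_⟩
    have h1 : c * ‖w (i + 1) - wo‖ ^ 2 ≤ V (i + 1) := by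
      have h2 : 0 ≤ ‖y (i + 1) - yo‖ ^ 2 + ‖x (i + 1) - x₁‖ ^ 2 := by positivity
      simp only [hV]
      linarith
    rw [← mul_div_assoc, le_div_iff₀ hc, mul_comm]
    exact h1.trans (hdec i)
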